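/- Let $\mathcal L$ be a formal language with connectives $\neg$ and $\vee$, and let $\mathbf L$ be a compact Tarski logic in $\mathcal L$ (reflexive, monotone, transitive derivability relation $\vdash_{\mathbf L}$) in which $\neg$ and $\vee$ are classical: $A\vdash_{\mathbf L} A\vee B$, $B\vdash_{\mathbf L} A\vee B$; if $\Gamma\cup\{A\}\vdash_{\mathbf L} C$ and $\Gamma\cup\{B\}\vdash_{\mathbf L} C$ then $\Gamma\cup\{A\vee B\}\vdash_{\mathbf L} C$; $A,\neg A\vdash_{\mathbf L} B$; if $\Gamma\cup\{A\}\vdash_{\mathbf L} B$ and $\Gamma\cup\{\neg A\}\vdash_{\mathbf L} B$ then $\Gamma\vdash_{\mathbf L} B$. Let $\emptyset\ne\Omega\subseteq\mathcal L$ be the set of abnormalities and $\Gamma\cup\{A\}\subseteq\mathcal L$. *Adaptive consequence.* An adaptive proof (at a stage) from $\Gamma$ is a possibly infinite (well-ordered) sequence of lines, each consisting of a formula and a condition (a set of abnormalities), where each line is obtained from earlier ones by: premise introduction ($B\in\Gamma$, on $\emptyset$); an inference of $\mathbf L$: from $B_1,\dots,B_n$ on $\Delta_1,\dots,\Delta_n$,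 with $\{B_1,\dots,B_n\}\vdash_{\mathbf L}B$, infer $B$ on $\Delta_1\cup\dots\cup\Delta_n$; or the conditional rule: from $B\vee ab$ on $\Delta$, with $ab\in\Omega$, infer $B$ on $\Delta\cup\{ab\}$. For a proof $P$ let $\Sigma_P$ be the set of the $\subset$-minimal non-empty finite $\Delta\subseteq\Omega$ such that $\bigvee\Delta$ is derived in $P$ on $\emptyset$, and $\Phi_P$ the set of $\subset$-minimal sets meeting every member of $\Sigma_P$. A line with formula $B$ and condition $\Delta$ is marked in $P$: under reliability ($\mathsf r$) iff $\Delta\cap\bigcup\Sigma_P\neq\emptyset$; under minimal abnormality ($\mathsf{ma}$) iff no $\varphi\in\Phi_P$ is disjoint from $\Delta$, or for some $\varphi\in\Phi_P$ there is no line of $P$ with formula $B$ and a condition disjoint from $\varphi$; under normal selections ($\mathsf{ns}$) iff $\Delta\neq\emptyset$ and $\bigvee\Delta$ is derived in $P$ on $\emptyset$. For $\mathsf{str}\in\{\mathsf r,\mathsf{ma},\mathsf{ns}\}$, $\Gamma\vdash^{\Omega,\mathbf L}_{\mathsf{str}}A$ iff there are a proof $P$ from $\Gamma$ and an unmarked line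 of $P$ with formula $A$ such that every extension (by further lines) of $P$ in which this line is marked can be further extended to one in which it is unmarked. *The framework.* Let $\mathcal R$ be a set of rule instances $A_1,\dots,A_n\to B$ ($n\ge0$) characterising $\mathbf L$: each rule is sound for $\vdash_{\mathbf L}$, and whenever $\Delta\vdash_{\mathbf L}B$ with $\Delta$ finite, $B$ is derivable from $\Delta$ by $\mathcal R$ (e.g. all rules with $\{A_1,\dots,A_n\}\vdash_{\mathbf L}B$). $\mathbf{ABF}^{\Omega}_{\mathbf L}(\Gamma)$ is the assumption-based framework with rules $\mathcal R$, premises $\Gamma$, assumptions $Ab=\{\neg B\mid B\in\Omega\}$ and contraries $\overline{\neg B}=B$. Write $\Delta\vdash^{\Gamma}C$ if some finite $\mathcal R$-deduction from $\Gamma\cup\Delta$ ends in $C$; for sets $\Delta,\Delta'\subseteq Ab$ of assumptions, $\Delta$ attacks $C\in Ab$ iff $\Delta\vdash^\Gamma\overline C$, and attacks $\Delta'$ iff it attacks some $C\in\Delta'$. $\Delta$ is closed iff $\Delta=\{C\in Ab\mid\Delta\vdash^\Gamma C\}$; conflict-free iff for no $C\in Ab$ both $\Delta\vdash^\Gamma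 C$ and $\Delta\vdash^\Gamma\overline C$; naive iff it is closed and $\subseteq$-maximal among the conflict-free sets; admissible iff it is closed, conflict-free and attacks every closed $\Delta'\subseteq Ab$ that attacks it; preferred iff it is $\subseteq$-maximal among the admissible sets; stable iff it is closed, conflict-free and attacks every member of $Ab\setminus\Delta$. For $\mathsf{sem}$ one of naive, preferred, stable, $\mathbf{ABF}\vdash^{\cup}_{\mathsf{sem}}A$ (resp. $\vdash^{\cap}_{\mathsf{sem}}$) iff $\Delta\vdash^\Gamma A$ for some (resp. every) $\mathsf{sem}$-set $\Delta$, and $\mathbf{ABF}\vdash^{\Cap}_{\mathsf{sem}}A$ iff $\bigcap\{\Delta\mid\Delta\text{ is a }\mathsf{sem}\text{-set}\}\vdash^\Gamma A$. *Theorem.* For each $\mathsf{sem}\in\{\text{naive},\text{preferred},\text{stable}\}$: 1. if $\Gamma$ is $\mathbf L$-consistent (some sentence is not $\mathbf L$-derivable from $\Gamma$), then $\mathbf{ABF}^{\Omega}_{\mathbf L}(\Gamma)\vdash^{\cup}_{\mathsf{sem}}A$ iff $\Gamma\vdash^{\Omega,\mathbf L}_{\mathsf{ns}}A$; 2. $\mathbf{ABF}^{\Omega}_{\mathbf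 L}(\Gamma)\vdash^{\cap}_{\mathsf{sem}}A$ iff $\Gamma\vdash^{\Omega,\mathbf L}_{\mathsf{ma}}A$; 3. $\mathbf{ABF}^{\Omega}_{\mathbf L}(\Gamma)\vdash^{\Cap}_{\mathsf{sem}}A$ iff $\Gamma\vdash^{\Omega,\mathbf L}_{\mathsf r}A$. -/

import Mathlib

universe u

namespace AdaptiveABA

/-! ### Formal languages and core logics -/

/-- The sentences of a formal language with a negation and a disjunction. As the language is
formal, a sentence of the form `¬ A` determines `A`. -/
class FormalLanguage (F : Type u) where
  neg : F → F
  vee : F → F → F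
  neg_injective : Function.Injective neg

open FormalLanguage

/-- A core (lower limit) logic: a compact Tarski logic in which `neg` and `vee` are classical
negation and classical disjunction. -/
structure CoreLogic (F : Type u) [FormalLanguage F] where
  /-- `entails Γ A` is the derivability relation `Γ ⊢ A`. -/
  entails : Set F → F → Prop
  reflexivity : ∀ {Γ : Set F} {A : F}, A ∈ Γ → entails Γ A
  monotonicity : ∀ {Γ Δ : Set F} {A : F}, Γ ⊆ Δ → entails Γ A → entails Δ A
  transitivity : ∀ {Γ Δ : Set F} {A : F},
    (∀ B ∈ Δ, entails Γ B) → entails (Γ ∪ Δ) A → entails Γ A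
  compactness : ∀ {Γ : Set F} {A : F}, entails Γ A → ∃ Δ ⊆ Γ, Δ.Finite ∧ entails Δ A
  or_intro_left : ∀ A B : F, entails {A} (vee A B)
  or_intro_right : ∀ A B : F, entails {B} (vee A B)
  or_elim : ∀ {Γ : Set F} {A B C : F},
    entails (Γ ∪ {A}) C → entails (Γ ∪ {B}) C → entails (Γ ∪ {vee A B}) C
  explosion : ∀ A B : F, entails {A, neg A} B
  neg_cases : ∀ {Γ : Set F} {A B : F},
    entails (Γ ∪ {A}) B → entails (Γ ∪ {neg A}) B → entails Γ B

/-- `Γ` is consistent: it does not derive every sentence. -/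
def CoreLogic.Consistent {F : Type u} [FormalLanguage F] (L : CoreLogic F) (Γ : Set F) : Prop :=
  ∃ B : F, ¬ L.entails Γ B

/-- `IsDisjunction Δ B`: the sentence `B` is a disjunction `⋁ Δ` of exactly the members of `Δ`,
in some order and with some bracketing. (So `Δ` is finite and non-empty.) -/
inductive IsDisjunction {F : Type u} [FormalLanguage F] : Set F → F → Prop
  | single (A : F) : IsDisjunction {A} A
  | disj {Δ Δ' : Set F} {B B' : F} :
      IsDisjunction Δ B → IsDisjunction Δ' B' → IsDisjunction (Δ ∪ Δ') (vee B B')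

/-! ### Adaptive logics: dynamic proofs, marking, final derivability -/

/-- A line of an adaptive proof: a formula and a condition, that is, the set of abnormalities
that are assumed to be false. The line number is the position in the proof; the justification
is required to exist in `Justified`. -/
structure Line (F : Type u) where
  formula : F
  condition : Set F

/-- The line may be added to a proof from `Γ` in which the lines `prev` occur. -/
inductive Justified {F : Type u} [FormalLanguage F] (L : CoreLogic F) (Ω Γ : Set F)
    (prev : Set (Line F)) : Line F → Prop
  /-- Premise introduction. -/
  | prem (A : F) : A ∈ Γ → Justified L Ω Γ prev ⟨A, ∅⟩
  /-- An inference of the core logic from finitely many earlier lines, whose conditions are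
  carried over. -/
  | inference (ps : List (Line F)) (B : F) : (∀ p ∈ ps, p ∈ prev) →
      L.entails {A | ∃ p ∈ ps, p.formula = A} B →
      Justified L Ω Γ prev ⟨B, {C | ∃ p ∈ ps, C ∈ p.condition}⟩
  /-- The conditional rule: from `A ∨ ab` on the condition `Δ` infer `A` on `Δ ∪ {ab}`. -/
  | conditional (A ab : F) (Δ : Set F) : ab ∈ Ω → ⟨vee A ab, Δ⟩ ∈ prev →
      Justified L Ω Γ prev ⟨A, Δ ∪ {ab}⟩

/-- An adaptive proof (at a stage) from `Γ`: a sequence of lines, possibly infinite, each of which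
is justified by earlier ones. Only the lines at positions below `length` belong to it. -/
structure AdaptiveProof {F : Type u} [FormalLanguage F] (L : CoreLogic F) (Ω Γ : Set F) where
  length : Ordinal.{u}
  line : Ordinal.{u} → Line F
  justified : ∀ i < length, Justified L Ω Γ (line '' Set.Iio i) (line i)

/-- The inclusion-minimal sets that meet every member of `S`. -/
def minimalChoiceSets {F : Type u} (S : Set (Set F)) : Set (Set F) :=
  {φ | Minimal (fun Θ : Set F => ∀ Δ ∈ S, (Δ ∩ Θ).Nonempty) φ}

/-- The adaptive strategies. -/
inductive Strategy
  | reliability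
  | minimalAbnormality
  | normalSelections

namespace AdaptiveProof

variable {F : Type u} [FormalLanguage F] {L : CoreLogic F} {Ω Γ : Set F}

/-- The lines that occur in the proof. -/
def lines (P : AdaptiveProof L Ω Γ) : Set (Line F) := P.line '' Set.Iio P.length

/-- `Q` extends `P`: it continues `P` with further lines. -/
def Extends (Q P : AdaptiveProof L Ω Γ) : Prop :=
  P.length ≤ Q.length ∧ ∀ i < P.length, Q.line i = P.line i

/-- The disjunction of the (finite, non-empty) set `Δ` of abnormalities has been derived on the
empty condition. -/
def DabDerived (P : AdaptiveProof L Ω Γ) (Δ : Set F) : Prop :=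
  Δ ⊆ Ω ∧ ∃ B : F, IsDisjunction Δ B ∧ ⟨B, ∅⟩ ∈ P.lines

/-- The minimal disjunctions of abnormalities that have been derived on the empty condition. -/
def minimalDabs (P : AdaptiveProof L Ω Γ) : Set (Set F) := {Δ | Minimal P.DabDerived Δ}

/-- The marking definitions: `l`, a line of `P`, is marked (retracted) in `P`.
* Reliability: its condition contains a member of a minimal disjunction of abnormalities.
* Minimal abnormality: no minimal choice set over the minimal disjunctions of abnormalities is
  disjoint from its condition, or for some minimal choice set `φ` its formula has not been derived
  on any condition disjoint from `φ`.
* Normal selections: the disjunction of its condition has been derived on the empty condition. -/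
def Marked (P : AdaptiveProof L Ω Γ) : Strategy → Line F → Prop
  | .reliability, l => (l.condition ∩ ⋃₀ P.minimalDabs).Nonempty
  | .minimalAbnormality, l =>
      (¬ ∃ φ ∈ minimalChoiceSets P.minimalDabs, Disjoint l.condition φ) ∨
      (∃ φ ∈ minimalChoiceSets P.minimalDabs,
        ¬ ∃ l' ∈ P.lines, l'.formula = l.formula ∧ Disjoint l'.condition φ)
  | .normalSelections, l => P.DabDerived l.condition

/-- `A` is finally derived at line `i` of `P`: line `i` is not marked, and each extension in which
it is marked can be further extended such that it is unmarked. -/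
def FinallyDerived (P : AdaptiveProof L Ω Γ) (str : Strategy) (i : Ordinal.{u}) (A : F) : Prop :=
  i < P.length ∧ (P.line i).formula = A ∧ ¬ P.Marked str (P.line i) ∧
    ∀ Q : AdaptiveProof L Ω Γ, Q.Extends P → Q.Marked str (Q.line i) →
      ∃ Q' : AdaptiveProof L Ω Γ, Q'.Extends Q ∧ ¬ Q'.Marked str (Q'.line i)

end AdaptiveProof

/-- The adaptive consequence relation: `A` is finally derivable in an adaptive proof from `Γ`. -/
def AdaptiveConsequence {F : Type u} [FormalLanguage F] (L : CoreLogic F) (Ω : Set F)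
    (str : Strategy) (Γ : Set F) (A : F) : Prop :=
  ∃ (P : AdaptiveProof L Ω Γ) (i : Ordinal.{u}), P.FinallyDerived str i A

/-! ### Deductive systems and assumption-based frameworks -/

/-- An inference rule `A₁, …, Aₙ → A`; the case `n = 0` is the rule `→ A`. -/
structure InferenceRule (F : Type u) where
  premises : List F
  conclusion : F

/-- The list `l` is a deduction from `Γ` by the rules in `R`. -/
def IsDeduction {F : Type u} (R : Set (InferenceRule F)) (Γ : Set F) (l : List F) : Prop :=
  ∀ (before : List F) (B : F) (after : List F), l = before ++ B :: after →
    B ∈ Γ ∨ ∃ r ∈ R, r.conclusion = B ∧ ∀ A ∈ r.premises, A ∈ before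

/-- `Γ ⊢_R A`: some deduction from `Γ` by the rules in `R` has `A` as its last element. -/
def Derives {F : Type u} (R : Set (InferenceRule F)) (Γ : Set F) (A : F) : Prop :=
  ∃ l : List F, IsDeduction R Γ l ∧ l.getLast? = some A

/-- The logic `L` is characterised by the (instances of) rules and axioms in `R`: these are
sound, and they derive from finitely many sentences whatever `L` does. -/
def CoreLogic.CharacterisedBy {F : Type u} [FormalLanguage F] (L : CoreLogic F)
    (R : Set (InferenceRule F)) : Prop :=
  (∀ r ∈ R, L.entails {A | A ∈ r.premises} r.conclusion) ∧
    ∀ (Δ : Set F) (A : F), Δ.Finite → L.entails Δ A → Derives R Δ A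

/-- An assumption-based framework. -/
structure ABFramework (F : Type u) where
  rules : Set (InferenceRule F)
  premises : Set F
  assumptions : Set F
  assumptions_nonempty : assumptions.Nonempty
  contrary : assumptions → F

/-- The argumentation semantics. -/
inductive Semantics
  | naive
  | preferred
  | stable

namespace ABFramework

variable {F : Type u} (T : ABFramework F)

/-- What follows by the rules from the premises together with the set `Δ` of assumptions. -/
def Follows (Δ : Set F) (A : F) : Prop := Derives T.rules (T.premises ∪ Δ) A

/-- `Δ` attacks the assumption `a`. -/
def Attacks (Δ : Set F) (a : T.assumptions) : Prop := T.Follows Δ (T.contrary a)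

/-- `Δ` attacks the set `Δ'` of assumptions. -/
def AttacksSet (Δ Δ' : Set F) : Prop := ∃ a : T.assumptions, (a : F) ∈ Δ' ∧ T.Attacks Δ a

def Closed (Δ : Set F) : Prop := Δ = {A | A ∈ T.assumptions ∧ T.Follows Δ A}

def ConflictFree (Δ : Set F) : Prop :=
  Δ ⊆ T.assumptions ∧ ∀ a : T.assumptions, ¬ T.Follows Δ a ∨ ¬ T.Follows Δ (T.contrary a)

def Naive (Δ : Set F) : Prop := T.Closed Δ ∧ Maximal T.ConflictFree Δ

def Admissible (Δ : Set F) : Prop :=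
  T.Closed Δ ∧ T.ConflictFree Δ ∧
    ∀ Δ' ⊆ T.assumptions, T.Closed Δ' → T.AttacksSet Δ' Δ → T.AttacksSet Δ Δ'

def Preferred (Δ : Set F) : Prop := Maximal T.Admissible Δ

def Stable (Δ : Set F) : Prop :=
  T.Closed Δ ∧ T.ConflictFree Δ ∧ ∀ a : T.assumptions, (a : F) ∉ Δ → T.Attacks Δ a

/-- The sets of assumptions that are acceptable according to the given semantics. -/
def extensions : Semantics → Set (Set F)
  | .naive => {Δ | T.Naive Δ}
  | .preferred => {Δ | T.Preferred Δ}
  | .stable => {Δ | T.Stable Δ}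

/-- `A` follows from some extension. -/
def Credulous (sem : Semantics) (A : F) : Prop := ∃ Δ ∈ T.extensions sem, T.Follows Δ A

/-- `A` follows from every extension. -/
def Skeptical (sem : Semantics) (A : F) : Prop := ∀ Δ ∈ T.extensions sem, T.Follows Δ A

/-- `A` follows from the intersection of all extensions. -/
def FromIntersection (sem : Semantics) (A : F) : Prop := T.Follows (⋂₀ T.extensions sem) A

end ABFramework

/-! ### The translation -/

/-- The assumption-based framework of an adaptive logic whose core logic is characterised by `R`:
the assumptions are the negations of abnormalities, and the contrary of `¬ A` is `A`. -/
noncomputable def translation {F : Type u} [FormalLanguage F] (R : Set (InferenceRule F))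
    (Ω : Set F) (hΩ : Ω.Nonempty) (Γ : Set F) : ABFramework F where
  rules := R
  premises := Γ
  assumptions := {B | ∃ A ∈ Ω, B = neg A}
  assumptions_nonempty := hΩ.elim fun A hA => ⟨neg A, A, hA, rfl⟩
  contrary := fun B => B.2.choose

theorem translation_contrary {F : Type u} [FormalLanguage F] (R : Set (InferenceRule F))
    (Ω : Set F) (hΩ : Ω.Nonempty) (Γ : Set F) (A : F) (hA : A ∈ Ω) :
    (translation R Ω hΩ Γ).contrary ⟨neg A, A, hA, rfl⟩ = A := by
  have h : ∃ A' ∈ Ω, neg A = neg A' := ⟨A, hA, rfl⟩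
  exact (neg_injective h.choose_spec.2).symm

/-- Every core logic is characterised by the set of all its finitary inferences. -/
theorem CoreLogic.characterisedBy_all {F : Type u} [FormalLanguage F] (L : CoreLogic F) :
    L.CharacterisedBy {r | L.entails {A | A ∈ r.premises} r.conclusion} := by
  refine ⟨fun r hr => hr, fun Δ A hΔ h => ?_⟩
  refine ⟨hΔ.toFinset.toList ++ [A], ?_, by simp⟩
  intro before B after e
  by_cases hB : B ∈ Δ
  · exact Or.inl hB
  right
  rcases List.append_eq_append_iff.1 e with ⟨c, rfl, hc⟩ | ⟨c, hc, hc'⟩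
  · cases c with
    | nil =>
      simp only [List.nil_append, List.cons.injEq] at hc
      refine ⟨⟨hΔ.toFinset.toList, A⟩, by simpa using h, hc.1, by simp⟩
    | cons x xs => simp at hc
  · cases c with
    | nil =>
      simp only [List.nil_append, List.cons.injEq] at hc'
      refine ⟨⟨hΔ.toFinset.toList, A⟩, by simpa using h, hc'.1.symm, by simp [hc]⟩
    | cons x xs =>
      exfalso
      simp only [List.cons_append, List.cons.injEq] at hc'
      have : B ∈ hΔ.toFinset.toList := by rw [hc, hc'.1]; simp
      exact hB (by simpa using this)

end AdaptiveABA

namespace AdaptiveABA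

open FormalLanguage

variable {F : Type u} [FormalLanguage F]

/-! ### Classical reasoning and compactness in a core logic -/

namespace CoreLogic

variable {L : CoreLogic F}

/-! Both sides are governed by one family: the maximal sets `M ⊆ Ω` whose negations are jointly
consistent with `Γ`.

On the argumentation side, `neg '' S` is conflict-free iff it is consistent with `Γ`, and a maximal
`M` derives every abnormality it omits, so it attacks every assumption outside it. Hence the naive,
preferred and stable sets are all exactly the sets `neg '' M` (`translation_extensions`).

On the adaptive side, every proof extends to a complete one, whose lines are exactly the sound ones
(`AdaptiveProof.Complete.lines_eq`). Further extensions add no new lines, so final derivability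
reduces to being unmarked at this fixed stage (`adaptiveConsequence_iff`). There a disjunction of
abnormalities is derived iff the negations of its disjuncts are inconsistent with `Γ`. For
consistent `Γ` it follows that the conditions unmarked under normal selections are the finite
subsets of the sets `M`, that the minimal choice sets are the complements `Ω \ M`, and that the
abnormalities in no minimal disjunction are those in every `M`. These facts match the three
strategies with "some extension", "every extension" and "the intersection of the extensions". -/

theorem entails_cut {X Y : Set F} {C : F} (h : ∀ B ∈ Y, L.entails X B) (hC : L.entails Y C) :
    L.entails X C :=
  L.transitivity h (L.monotonicity Set.subset_union_right hC)

theorem not_consistent_iff {X : Set F} : ¬ L.Consistent X ↔ ∀ B, L.entails X B := by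
  simp [Consistent]

theorem Consistent.anti {X Y : Set F} (h : X ⊆ Y) (hY : L.Consistent Y) : L.Consistent X := by
  obtain ⟨B, hB⟩ := hY
  exact ⟨B, fun h' => hB (L.monotonicity h h')⟩

theorem not_consistent_of_contradiction {X : Set F} {B : F} (h : L.entails X B)
    (h' : L.entails X (neg B)) : ¬ L.Consistent X := by
  rw [not_consistent_iff]
  intro C
  refine entails_cut ?_ (L.explosion B C)
  rintro D (rfl | rfl) <;> assumption

theorem entails_of_not_consistent_neg {X : Set F} {B : F} (h : ¬ L.Consistent (X ∪ {neg B})) :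
    L.entails X B :=
  L.neg_cases (L.reflexivity (Or.inr rfl)) (not_consistent_iff.1 h B)

/-- A deduction theorem for negated abnormalities: it supplies the disjunction to which the
conditional rule is applied in a complete proof. The next lemma is the converse, which makes that
rule sound. -/
theorem entails_vee_of_entails_neg {X : Set F} {A B : F} (h : L.entails (X ∪ {neg B}) A) :
    L.entails X (vee A B) := by
  refine L.neg_cases (A := B) (L.monotonicity Set.subset_union_right (L.or_intro_right A B)) ?_
  refine entails_cut (Y := {A}) ?_ (L.or_intro_left A B)
  rintro _ rfl
  exact h

theorem entails_of_vee_of_neg {X : Set F} {A B : F} (h : L.entails X (vee A B))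
    (h' : L.entails X (neg B)) : L.entails X A := by
  have key : L.entails ({neg B} ∪ {vee A B}) A := by
    refine L.or_elim (L.reflexivity (Or.inr rfl)) ?_
    rw [Set.union_comm]
    exact L.explosion B A
  refine entails_cut ?_ key
  rintro C (rfl | rfl) <;> assumption

/-- A sentence that follows from `Γ` and a set of negations follows from `Γ` and finitely many of
those negations. -/
theorem exists_finite_of_entails {Γ S : Set F} {A : F} (h : L.entails (Γ ∪ neg '' S) A) :
    ∃ Θ ⊆ S, Θ.Finite ∧ L.entails (Γ ∪ neg '' Θ) A := by
  obtain ⟨Δ, hΔ, hfin, hA⟩ := L.compactness h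
  obtain ⟨Θ, hΘ, hΘfin, hΘim⟩ := Set.exists_subset_image_finite_and.1
    ⟨Δ ∩ neg '' S, Set.inter_subset_right, hfin.inter_of_left _, rfl⟩
  refine ⟨Θ, hΘ, hΘfin, L.monotonicity ?_ hA⟩
  intro B hB
  rw [← hΘim]
  rcases hΔ hB with h | h
  · exact Or.inl h
  · exact Or.inr ⟨hB, h⟩

/-- Compactness concerns a single conclusion, whereas inconsistency concerns all of them. Treating
one contradictory pair `B`, `neg B` suffices, by explosion. -/
theorem exists_finite_of_not_consistent {Γ S : Set F} (h : ¬ L.Consistent (Γ ∪ neg '' S)) :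
    ∃ Θ ⊆ S, Θ.Finite ∧ ¬ L.Consistent (Γ ∪ neg '' Θ) := by
  rcases isEmpty_or_nonempty F with hF | ⟨⟨B⟩⟩
  -- In an empty language no set is consistent, since there is no underivable sentence.
  · exact ⟨∅, Set.empty_subset _, Set.finite_empty, fun ⟨B, _⟩ => hF.elim B⟩
  rw [not_consistent_iff] at h
  obtain ⟨Θ, hΘ, hfin, hB⟩ := exists_finite_of_entails (h B)
  obtain ⟨Θ', hΘ', hfin', hB'⟩ := exists_finite_of_entails (h (neg B))
  refine ⟨Θ ∪ Θ', Set.union_subset hΘ hΘ', hfin.union hfin', not_consistent_of_contradiction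
    (L.monotonicity ?_ hB) (L.monotonicity ?_ hB')⟩
  · exact Set.union_subset_union_right _ (Set.image_mono Set.subset_union_left)
  · exact Set.union_subset_union_right _ (Set.image_mono Set.subset_union_right)

end CoreLogic

/-! ### Disjunctions -/

namespace IsDisjunction

variable {L : CoreLogic F} {Δ : Set F} {B : F}

theorem finite (h : IsDisjunction Δ B) : Δ.Finite := by
  induction h with
  | single A => exact Set.finite_singleton A
  | disj _ _ h₁ h₂ => exact h₁.union h₂

theorem nonempty (h : IsDisjunction Δ B) : Δ.Nonempty := by
  induction h with
  | single A => exact Set.singleton_nonempty A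
  | disj _ _ h₁ _ => exact h₁.inl

/-- Excluded middle for `⋁ Δ`: either it holds or all its disjuncts fail. Each single disjunct is
split by `neg_cases`, and the negations accumulate along the induction. -/
theorem cases_entails (h : IsDisjunction Δ B) : ∀ {X : Set F} {C : F},
    L.entails (X ∪ {B}) C → L.entails (X ∪ neg '' Δ) C → L.entails X C := by
  induction h with
  | single A =>
    intro X C h₁ h₂
    rw [Set.image_singleton] at h₂
    exact L.neg_cases h₁ h₂
  | @disj Δ Δ' B B' _ _ ih₁ ih₂ =>
    intro X C h₁ h₂
    have weaken : ∀ {Y : Set F}, X ⊆ Y → L.entails Y (vee B B') → L.entails Y C := by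
      intro Y hXY hY
      refine CoreLogic.entails_cut ?_ h₁
      rintro D (hD | rfl)
      · exact L.reflexivity (hXY hD)
      · exact hY
    refine ih₁ (weaken Set.subset_union_left
      (L.monotonicity Set.subset_union_right (L.or_intro_left B B'))) (ih₂ (weaken ?_
      (L.monotonicity Set.subset_union_right (L.or_intro_right B B'))) ?_)
    · exact Set.subset_union_left.trans Set.subset_union_left
    · rwa [Set.union_assoc, ← Set.image_union]

theorem not_consistent (h : IsDisjunction Δ B) : ¬ L.Consistent (neg '' Δ ∪ {B}) := by
  induction h with
  | single A =>
    exact CoreLogic.not_consistent_of_contradiction (B := A) (L.reflexivity (Or.inr rfl))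
      (L.reflexivity (Or.inl ⟨A, rfl, rfl⟩))
  | disj _ _ ih₁ ih₂ =>
    rw [CoreLogic.not_consistent_iff] at ih₁ ih₂ ⊢
    intro C
    refine L.or_elim (L.monotonicity ?_ (ih₁ C)) (L.monotonicity ?_ (ih₂ C))
    · exact Set.union_subset_union_left _ (Set.image_mono Set.subset_union_left)
    · exact Set.union_subset_union_left _ (Set.image_mono Set.subset_union_right)

/-- A disjunction follows iff the negations of all disjuncts are jointly excluded. -/
theorem entails_iff (h : IsDisjunction Δ B) {X : Set F} :
    L.entails X B ↔ ¬ L.Consistent (X ∪ neg '' Δ) := by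
  constructor
  · intro hB
    have h' := h.not_consistent (L := L)
    rw [CoreLogic.not_consistent_iff] at h' ⊢
    intro C
    refine CoreLogic.entails_cut ?_ (h' C)
    rintro D (hD | rfl)
    · exact L.reflexivity (Or.inr hD)
    · exact L.monotonicity Set.subset_union_left hB
  · intro hX
    exact h.cases_entails (L.reflexivity (Or.inr rfl)) (CoreLogic.not_consistent_iff.1 hX B)

theorem exists_of_finite (hfin : Δ.Finite) (hne : Δ.Nonempty) : ∃ B, IsDisjunction Δ B := by
  induction Δ, hfin using Set.Finite.induction_on with
  | empty => exact absurd rfl hne.ne_empty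
  | @insert a S _ _ ih =>
    rcases S.eq_empty_or_nonempty with rfl | hS
    · exact ⟨a, by simpa using IsDisjunction.single a⟩
    · obtain ⟨B, hB⟩ := ih hS
      exact ⟨vee a B, (IsDisjunction.single a).disj hB⟩

end IsDisjunction

/-! ### Deductions by rules -/



omit [FormalLanguage F] in
theorem IsDeduction.mono {R : Set (InferenceRule F)} {Γ Γ' : Set F} (h : Γ ⊆ Γ') {l : List F}
    (hl : IsDeduction R Γ l) : IsDeduction R Γ' l := fun b B a e =>
  (hl b B a e).imp (fun hB => h hB) id

/-- Induction removes the last element, because an element is justified by the prefix before it. -/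
theorem IsDeduction.entails {L : CoreLogic F} {R : Set (InferenceRule F)}
    (hR : ∀ r ∈ R, L.entails {A | A ∈ r.premises} r.conclusion) {Γ : Set F} {l : List F}
    (hl : IsDeduction R Γ l) : ∀ A ∈ l, L.entails Γ A := by
  induction l using List.reverseRecOn with
  | nil => simp
  | append_singleton l B ih =>
    have ih' := ih (fun b C a e => hl b C (a ++ [B]) (by simp [e]))
    intro A hA
    rcases List.mem_append.1 hA with hA | hA
    · exact ih' A hA
    · obtain rfl := List.mem_singleton.1 hA
      rcases hl l A [] rfl with h | ⟨r, hr, rfl, hprem⟩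
      · exact L.reflexivity h
      · exact CoreLogic.entails_cut (fun C hC => ih' C (hprem C hC)) (hR r hr)

theorem CoreLogic.CharacterisedBy.derives_iff {L : CoreLogic F} {R : Set (InferenceRule F)}
    (hR : L.CharacterisedBy R) {X : Set F} {A : F} : Derives R X A ↔ L.entails X A := by
  constructor
  · rintro ⟨l, hl, hA⟩
    exact hl.entails hR.1 A (List.mem_of_getLast? hA)
  · intro h
    obtain ⟨Δ, hΔ, hfin, hA⟩ := L.compactness h
    obtain ⟨l, hl, hlast⟩ := hR.2 Δ A hfin hA
    exact ⟨l, hl.mono hΔ, hlast⟩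


/-! ### Complete proofs -/

theorem Justified.mono {L : CoreLogic F} {Ω Γ : Set F} {S S' : Set (Line F)} (h : S ⊆ S')
    {l : Line F} (hl : Justified L Ω Γ S l) : Justified L Ω Γ S' l := by
  cases hl with
  | prem A hA => exact .prem A hA
  | inference ps B hps hB => exact .inference ps B (fun p hp => h (hps p hp)) hB
  | conditional A ab Δ hab hl => exact .conditional A ab Δ hab (h hl)

/-- A line that is justified by the union of an increasing sequence of sets of lines is justified
by one of them. -/
theorem Justified.exists_of_iUnion {L : CoreLogic F} {Ω Γ : Set F} {S : ℕ → Set (Line F)}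
    (hS : Monotone S) {l : Line F} (hl : Justified L Ω Γ (⋃ n, S n) l) :
    ∃ n, Justified L Ω Γ (S n) l := by
  cases hl with
  | prem A hA => exact ⟨0, .prem A hA⟩
  | inference ps B hps hB =>
    have h : ∃ n, ∀ p ∈ ps, p ∈ S n := by
      clear hB
      induction ps with
      | nil => exact ⟨0, by simp⟩
      | cons q qs ih =>
        obtain ⟨n, hn⟩ := ih fun p hp => hps p (List.mem_cons_of_mem q hp)
        obtain ⟨m, hm⟩ := Set.mem_iUnion.1 (hps q List.mem_cons_self)
        refine ⟨max n m, fun p hp => ?_⟩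
        rcases List.mem_cons.1 hp with rfl | hp
        · exact hS (le_max_right n m) hm
        · exact hS (le_max_left n m) (hn p hp)
    exact h.imp fun n hn => .inference ps B hn hB
  | conditional A ab Δ hab hl =>
    exact (Set.mem_iUnion.1 hl).imp fun n hn => .conditional A ab Δ hab hn

namespace AdaptiveProof

variable {L : CoreLogic F} {Ω Γ : Set F} {P Q : AdaptiveProof L Ω Γ}

theorem Extends.lines_subset (h : Q.Extends P) : P.lines ⊆ Q.lines := by
  rintro _ ⟨i, hi, rfl⟩
  exact ⟨i, lt_of_lt_of_le hi h.1, h.2 i hi⟩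

theorem justified_lines {l : Line F} (hl : l ∈ P.lines) : Justified L Ω Γ P.lines l := by
  obtain ⟨i, hi, rfl⟩ := hl
  exact (P.justified i hi).mono (Set.image_mono (Set.Iio_subset_Iio (le_of_lt hi)))

/-- The empty proof. -/
def empty (L : CoreLogic F) (Ω Γ : Set F) (A : F) : AdaptiveProof L Ω Γ where
  length := 0
  line := fun _ => ⟨A, ∅⟩
  justified := fun _ hi => absurd hi (not_lt_zero)

/-- A proof can be continued by a well-ordered family of lines each of which is justified by the
lines before it. -/
theorem exists_extends_of_family (Q : AdaptiveProof L Ω Γ) {α : Type u} [LinearOrder α]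
    [WellFoundedLT α] (f : α → Line F)
    (hf : ∀ a, Justified L Ω Γ (Q.lines ∪ f '' Set.Iio a) (f a)) :
    ∃ P : AdaptiveProof L Ω Γ, P.Extends Q ∧ P.lines = Q.lines ∪ Set.range f := by
  classical
  -- The new lines are placed directly after `Q`, in the order type of `α`.
  let pos : α → Ordinal.{u} := fun a => Q.length + Ordinal.typein (α := α) (· < ·) a
  let g : Ordinal.{u} → Line F := fun i =>
    if h : ∃ a, pos a = i then f h.choose else Q.line i
  have pos_lt : ∀ {a b}, pos a < pos b ↔ a < b := by
    intro a b
    simp [pos]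
  have pos_inj : ∀ {a b}, pos a = pos b → a = b := by
    intro a b h
    rcases lt_trichotomy a b with h' | h' | h'
    · exact absurd h (pos_lt.2 h').ne
    · exact h'
    · exact absurd h (pos_lt.2 h').ne'
  have g_pos : ∀ a, g (pos a) = f a := by
    intro a
    have h : ∃ b, pos b = pos a := ⟨a, rfl⟩
    simp only [g, dif_pos h]
    rw [pos_inj h.choose_spec]
  have g_old : ∀ i < Q.length, g i = Q.line i := by
    intro i hi
    refine dif_neg ?_
    rintro ⟨a, rfl⟩
    exact absurd hi (not_lt.2 le_self_add)
  have cases_lt : ∀ i < Q.length + Ordinal.type (α := α) (· < ·),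
      i < Q.length ∨ ∃ a, pos a = i := by
    intro i hi
    rcases lt_or_ge i Q.length with h | h
    · exact Or.inl h
    · right
      obtain ⟨j, rfl⟩ := le_iff_exists_add.1 h
      have hj : j < Ordinal.type (α := α) (· < ·) := lt_of_add_lt_add_left hi
      obtain ⟨a, ha⟩ := Ordinal.typein_surj (α := α) (· < ·) hj
      exact ⟨a, by simp [pos, ha]⟩
  have pos_lt_length : ∀ a, pos a < Q.length + Ordinal.type (α := α) (· < ·) := fun a =>
    (add_lt_add_iff_left _).2 (Ordinal.typein_lt_type _ a)
  refine ⟨⟨Q.length + Ordinal.type (α := α) (· < ·), g, ?_⟩, ⟨le_self_add, g_old⟩, ?_⟩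
  · intro i hi
    rcases cases_lt i hi with h | ⟨a, rfl⟩
    · rw [g_old i h]
      refine (Q.justified i h).mono ?_
      rintro _ ⟨j, hj, rfl⟩
      exact ⟨j, hj, g_old j (lt_trans hj h)⟩
    · rw [g_pos]
      refine (hf a).mono ?_
      rintro _ (⟨j, hj, rfl⟩ | ⟨b, hb, rfl⟩)
      · exact ⟨j, Set.mem_Iio.2 (lt_of_lt_of_le (Set.mem_Iio.1 hj) le_self_add), g_old j hj⟩
      · exact ⟨pos b, pos_lt.2 hb, g_pos b⟩
  · apply Set.Subset.antisymm
    · rintro _ ⟨i, hi, rfl⟩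
      rcases cases_lt i hi with h | ⟨a, rfl⟩
      · exact Or.inl ⟨i, h, (g_old i h).symm⟩
      · exact Or.inr ⟨a, (g_pos a).symm⟩
    · rintro _ (⟨j, hj, rfl⟩ | ⟨b, rfl⟩)
      · exact ⟨j, Set.mem_Iio.2 (lt_of_lt_of_le (Set.mem_Iio.1 hj) le_self_add), g_old j hj⟩
      · exact ⟨pos b, pos_lt_length b, g_pos b⟩

/-- A proof is complete if every line that may be added to it occurs in it. -/
def Complete (P : AdaptiveProof L Ω Γ) : Prop := ∀ l, Justified L Ω Γ P.lines l → l ∈ P.lines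

/-- Each rule uses finitely many earlier lines, so adding all justified lines repeatedly closes off
after `ω` stages. A well-order of the lines within each stage turns the union into a proof. -/
theorem exists_extends_complete (Q : AdaptiveProof L Ω Γ) :
    ∃ P : AdaptiveProof L Ω Γ, P.Extends Q ∧ P.Complete := by
  classical
  let D : ℕ → Set (Line F) := fun n =>
    Nat.rec Q.lines (fun _ S => S ∪ {l | Justified L Ω Γ S l}) n
  have D_succ : ∀ n, D (n + 1) = D n ∪ {l | Justified L Ω Γ (D n) l} := fun n => rfl
  have D_mono : Monotone D := monotone_nat_of_le_succ fun n => by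
    rw [D_succ]
    exact Set.subset_union_left
  -- For `n = 0` truncated subtraction gives `D 0` again: the lines of `Q` are justified by lines of
  -- `Q`.
  have D_justified : ∀ n, ∀ l ∈ D n, Justified L Ω Γ (D (n - 1)) l := by
    intro n
    induction n with
    | zero => exact fun l hl => Q.justified_lines hl
    | succ n ih =>
      rintro l (hl | hl)
      · exact (ih l hl).mono (D_mono (by omega))
      · exact hl
  obtain ⟨_, _⟩ := exists_wellFoundedLT (Line F)
  -- With the stage as the leading coordinate, all of stage `n` precedes stage `n + 1`. A line
  -- recurs at every later stage, which is harmless.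
  let f : {p : ℕ ×ₗ Line F // (ofLex p).2 ∈ D (ofLex p).1} → Line F := fun p => (ofLex p.1).2
  have hf : ∀ a, Justified L Ω Γ (Q.lines ∪ f '' Set.Iio a) (f a) := by
    rintro ⟨⟨n, l⟩, hl⟩
    cases n with
    | zero => exact (Q.justified_lines hl).mono Set.subset_union_left
    | succ n =>
      refine (D_justified (n + 1) l hl).mono fun l' hl' => Or.inr ?_
      refine ⟨⟨toLex (n, l'), hl'⟩, ?_, rfl⟩
      exact Prod.Lex.toLex_lt_toLex.2 (Or.inl (Nat.lt_succ_self n))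
  obtain ⟨P, hP, hlines⟩ := Q.exists_extends_of_family f hf
  have hD : P.lines = ⋃ n, D n := by
    rw [hlines]
    apply Set.Subset.antisymm
    · rintro l (hl | ⟨⟨p, hp⟩, rfl⟩)
      · exact Set.mem_iUnion.2 ⟨0, hl⟩
      · exact Set.mem_iUnion.2 ⟨_, hp⟩
    · intro l hl
      obtain ⟨n, hn⟩ := Set.mem_iUnion.1 hl
      exact Or.inr ⟨⟨toLex (n, l), hn⟩, rfl⟩
  refine ⟨P, hP, fun l hl => ?_⟩
  rw [hD] at hl ⊢
  obtain ⟨n, hn⟩ := hl.exists_of_iUnion D_mono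
  exact Set.mem_iUnion.2 ⟨n + 1, Or.inr hn⟩

end AdaptiveProof

/-- The lines that are derivable at all: the formula follows from `Γ` and the falsity of the
members of the condition. -/
def Sound (L : CoreLogic F) (Ω Γ : Set F) (l : Line F) : Prop :=
  l.condition ⊆ Ω ∧ l.condition.Finite ∧ L.entails (Γ ∪ neg '' l.condition) l.formula

theorem Justified.sound {L : CoreLogic F} {Ω Γ : Set F} {S : Set (Line F)}
    (hS : ∀ l ∈ S, Sound L Ω Γ l) {l : Line F} (hl : Justified L Ω Γ S l) : Sound L Ω Γ l := by
  cases hl with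
  | prem A hA =>
    exact ⟨Set.empty_subset _, Set.finite_empty, L.reflexivity (Or.inl hA)⟩
  | inference ps B hps hB =>
    refine ⟨?_, ?_, ?_⟩
    · rintro C ⟨p, hp, hC⟩
      exact (hS p (hps p hp)).1 hC
    · have : {C | ∃ p ∈ ps, C ∈ p.condition} = ⋃ p ∈ {p | p ∈ ps}, p.condition := by
        ext C
        simp
      simp only [this]
      exact (List.finite_toSet ps).biUnion fun p hp => (hS p (hps p hp)).2.1
    · refine CoreLogic.entails_cut ?_ hB
      rintro _ ⟨p, hp, rfl⟩
      refine L.monotonicity ?_ (hS p (hps p hp)).2.2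
      exact Set.union_subset_union_right _ (Set.image_mono fun C hC => ⟨p, hp, hC⟩)
  | conditional A ab Δ hab hl =>
    obtain ⟨h₁, h₂, h₃⟩ := hS _ hl
    refine ⟨Set.union_subset h₁ (Set.singleton_subset_iff.2 hab),
      h₂.union (Set.finite_singleton ab), CoreLogic.entails_of_vee_of_neg (B := ab)
        (L.monotonicity ?_ h₃) (L.reflexivity (Or.inr ⟨ab, Or.inr rfl, rfl⟩))⟩
    exact Set.union_subset_union_right _ (Set.image_mono Set.subset_union_left)

namespace AdaptiveProof

variable {L : CoreLogic F} {Ω Γ : Set F} {P Q : AdaptiveProof L Ω Γ}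

theorem sound_of_mem_lines {l : Line F} (hl : l ∈ P.lines) : Sound L Ω Γ l := by
  obtain ⟨i, hi, rfl⟩ := hl
  induction i using WellFoundedLT.induction with
  | ind i ih =>
    refine (P.justified i hi).sound ?_
    rintro _ ⟨j, hj, rfl⟩
    exact ih j hj (lt_trans (Set.mem_Iio.1 hj) (Set.mem_Iio.1 hi))

/-- Induction on the condition. With none, compactness leaves finitely many premises and one
inference; each further abnormality is moved into a disjunct and then discharged by the conditional
rule. -/
theorem Complete.mem_lines (hP : P.Complete) {Θ : Set F} (hΘ : Θ ⊆ Ω) (hfin : Θ.Finite) :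
    ∀ {B : F}, L.entails (Γ ∪ neg '' Θ) B → ⟨B, Θ⟩ ∈ P.lines := by
  induction Θ, hfin using Set.Finite.induction_on with
  | empty =>
    intro B hB
    rw [Set.image_empty, Set.union_empty] at hB
    obtain ⟨Δ, hΔ, hfin, hB⟩ := L.compactness hB
    have h := hP _ (.inference (hfin.toFinset.toList.map fun A => ⟨A, ∅⟩) B ?_ ?_)
    · simpa using h
    · intro p hp
      obtain ⟨A, hA, rfl⟩ := List.mem_map.1 hp
      exact hP _ (.prem A (hΔ (by simpa using hA)))
    · simpa using hB
  | @insert b S _ _ ih =>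
    intro B hB
    rw [← Set.union_singleton]
    refine hP _ (.conditional B b S (hΘ (Set.mem_insert b S))
      (ih ((Set.subset_insert b S).trans hΘ) (CoreLogic.entails_vee_of_entails_neg ?_)))
    rwa [Set.union_assoc, Set.union_singleton, ← Set.image_insert_eq]

theorem Complete.lines_eq (hP : P.Complete) : P.lines = {l | Sound L Ω Γ l} :=
  Set.Subset.antisymm (fun _ hl => sound_of_mem_lines hl)
    fun _ hl => hP.mem_lines hl.1 hl.2.1 hl.2.2

theorem Complete.extends_complete (hP : P.Complete) (h : Q.Extends P) : Q.Complete :=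
  fun _ hl => h.lines_subset (by
    rw [hP.lines_eq]
    exact hl.sound fun _ h => sound_of_mem_lines h)

end AdaptiveProof

/-! ### Markings in complete proofs -/

/-- The sets of abnormalities whose disjunction follows from `Γ`. -/
def dabs (L : CoreLogic F) (Ω Γ : Set F) : Set (Set F) :=
  {Δ | Δ ⊆ Ω ∧ Δ.Finite ∧ Δ.Nonempty ∧ ¬ L.Consistent (Γ ∪ neg '' Δ)}

theorem AdaptiveProof.Complete.dabDerived_iff {L : CoreLogic F} {Ω Γ : Set F}
    {P : AdaptiveProof L Ω Γ} (hP : P.Complete) {Δ : Set F} :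
    P.DabDerived Δ ↔ Δ ∈ dabs L Ω Γ := by
  constructor
  · rintro ⟨hΔ, B, hB, hl⟩
    have h := (sound_of_mem_lines hl).2.2
    rw [Set.image_empty, Set.union_empty] at h
    exact ⟨hΔ, hB.finite, hB.nonempty, hB.entails_iff.1 h⟩
  · rintro ⟨hΔ, hfin, hne, h⟩
    obtain ⟨B, hB⟩ := IsDisjunction.exists_of_finite hfin hne
    refine ⟨hΔ, B, hB, hP.mem_lines (Set.empty_subset _) Set.finite_empty ?_⟩
    rw [Set.image_empty, Set.union_empty]
    exact hB.entails_iff.2 h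

omit [FormalLanguage F] in
theorem exists_minimal_subset {S : Set (Set F)} {Δ : Set F} (hfin : Δ.Finite) (hΔ : Δ ∈ S) :
    ∃ Δ' ⊆ Δ, Minimal (· ∈ S) Δ' := by
  obtain ⟨Δ', hsub, hmin⟩ := (hfin.finite_subsets.inter_of_right S).exists_le_minimal
    ⟨hΔ, Set.mem_ofPred.2 subset_rfl⟩
  exact ⟨Δ', hsub, hmin.prop.1, fun E hE hle =>
    hmin.le_of_le ⟨hE, hle.trans hsub⟩ hle⟩

omit [FormalLanguage F] in
/-- Only minimal members matter for minimal choice sets. -/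
theorem minimalChoiceSets_minimal {S : Set (Set F)} (hS : ∀ Δ ∈ S, Δ.Finite) :
    minimalChoiceSets {Δ | Minimal (· ∈ S) Δ} = minimalChoiceSets S := by
  have h : (fun Θ : Set F => ∀ Δ ∈ {Δ | Minimal (· ∈ S) Δ}, (Δ ∩ Θ).Nonempty) =
      fun Θ : Set F => ∀ Δ ∈ S, (Δ ∩ Θ).Nonempty := by
    funext Θ
    refine propext ⟨fun h Δ hΔ => ?_, fun h Δ hΔ => h Δ hΔ.1⟩
    obtain ⟨Δ', hsub, hmin⟩ := exists_minimal_subset (hS Δ hΔ) hΔ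
    exact (h Δ' hmin).mono (Set.inter_subset_inter_left _ hsub)
  simp only [minimalChoiceSets, h]

/-- A line is marked in a complete proof. -/
def MarkedComplete (L : CoreLogic F) (Ω Γ : Set F) (A : F) (Θ : Set F) : Strategy → Prop
  | .reliability => ∃ Δ, Minimal (· ∈ dabs L Ω Γ) Δ ∧ (Θ ∩ Δ).Nonempty
  | .minimalAbnormality =>
      (¬ ∃ φ ∈ minimalChoiceSets (dabs L Ω Γ), Disjoint Θ φ) ∨
      (∃ φ ∈ minimalChoiceSets (dabs L Ω Γ), ¬ ∃ Θ', Sound L Ω Γ ⟨A, Θ'⟩ ∧ Disjoint Θ' φ)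
  | .normalSelections => Θ ∈ dabs L Ω Γ

theorem AdaptiveProof.Complete.marked_iff {L : CoreLogic F} {Ω Γ : Set F}
    {P : AdaptiveProof L Ω Γ} (hP : P.Complete) (str : Strategy) (l : Line F) :
    P.Marked str l ↔ MarkedComplete L Ω Γ l.formula l.condition str := by
  have hdab : P.DabDerived = (· ∈ dabs L Ω Γ) := funext fun Δ => propext hP.dabDerived_iff
  have hmin : P.minimalDabs = {Δ | Minimal (· ∈ dabs L Ω Γ) Δ} := by
    rw [minimalDabs, hdab]
  cases str with
  | reliability =>
    simp only [Marked, MarkedComplete, hmin]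
    constructor
    · rintro ⟨B, hB, Δ, hΔ, hBΔ⟩
      exact ⟨Δ, hΔ, B, hB, hBΔ⟩
    · rintro ⟨Δ, hΔ, B, hB, hBΔ⟩
      exact ⟨B, hB, Δ, hΔ, hBΔ⟩
  | minimalAbnormality =>
    simp only [Marked, MarkedComplete, hmin,
      minimalChoiceSets_minimal (S := dabs L Ω Γ) fun _ h => h.2.1]
    refine or_congr Iff.rfl (exists_congr fun φ => and_congr_right fun _ => not_congr ?_)
    rw [hP.lines_eq]
    constructor
    · rintro ⟨⟨B, Θ'⟩, hs, rfl, hd⟩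
      exact ⟨Θ', hs, hd⟩
    · rintro ⟨Θ', hs, hd⟩
      exact ⟨⟨_, Θ'⟩, hs, rfl, hd⟩
  | normalSelections => exact hP.dabDerived_iff

/-- Marking in a complete proof depends only on `Γ`, and extensions of complete proofs are complete.
A mark there is thus irrevocable, and its absence permanent. -/
theorem adaptiveConsequence_iff {L : CoreLogic F} {Ω Γ : Set F} {str : Strategy} {A : F} :
    AdaptiveConsequence L Ω str Γ A ↔
      ∃ Θ, Sound L Ω Γ ⟨A, Θ⟩ ∧ ¬ MarkedComplete L Ω Γ A Θ str := by
  constructor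
  · rintro ⟨P, i, hi, rfl, _, hfinal⟩
    refine ⟨(P.line i).condition, AdaptiveProof.sound_of_mem_lines ⟨i, hi, rfl⟩, fun hm => ?_⟩
    obtain ⟨Q, hQ, hQc⟩ := P.exists_extends_complete
    have hline : Q.line i = P.line i := hQ.2 i hi
    obtain ⟨Q', hQ', hun⟩ := hfinal Q hQ (by rwa [hQc.marked_iff, hline])
    rw [(hQc.extends_complete hQ').marked_iff, hQ'.2 i (hi.trans_le hQ.1), hline] at hun
    exact hun hm
  · rintro ⟨Θ, hs, hm⟩
    obtain ⟨P, -, hP⟩ := (AdaptiveProof.empty L Ω Γ A).exists_extends_complete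
    obtain ⟨i, hi, hline⟩ := hP.mem_lines hs.1 hs.2.1 hs.2.2
    refine ⟨P, i, hi, by rw [hline], ?_, fun Q hQ hmarked => ?_⟩
    · rwa [hP.marked_iff, hline]
    · rw [(hP.extends_complete hQ).marked_iff, hQ.2 i hi, hline] at hmarked
      exact absurd hmarked hm

end AdaptiveABA

namespace AdaptiveABA

open FormalLanguage

variable {F : Type u} [FormalLanguage F] {L : CoreLogic F} {Ω Γ : Set F}

/-! ### Maximal consistent sets of negated abnormalities -/

/-- The negations of the members of `S ⊆ Ω` are jointly consistent with `Γ`. -/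
def Compatible (L : CoreLogic F) (Ω Γ S : Set F) : Prop := S ⊆ Ω ∧ L.Consistent (Γ ∪ neg '' S)

theorem union_neg_image_mono {S S' : Set F} (h : S ⊆ S') : Γ ∪ neg '' S ⊆ Γ ∪ neg '' S' :=
  Set.union_subset_union_right _ (Set.image_mono h)

theorem Compatible.anti {S S' : Set F} (h : S ⊆ S') (hS' : Compatible L Ω Γ S') :
    Compatible L Ω Γ S :=
  ⟨h.trans hS'.1, hS'.2.anti (union_neg_image_mono h)⟩

/-- Zorn's lemma: an inconsistency of the union of a chain uses finitely many negations, which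
already come from one member. -/
theorem Compatible.exists_maximal {S : Set F} (hS : Compatible L Ω Γ S) :
    ∃ M, S ⊆ M ∧ Maximal (Compatible L Ω Γ) M := by
  refine zorn_subset_nonempty {M | Compatible L Ω Γ M} ?_ S hS
  intro c hc hchain hne
  refine ⟨⋃₀ c, ⟨Set.sUnion_subset fun M hM => (hc hM).1, ?_⟩, fun M => Set.subset_sUnion_of_mem⟩
  by_contra hincons
  obtain ⟨Θ, hΘ, hfin, hinc⟩ := CoreLogic.exists_finite_of_not_consistent hincons
  obtain ⟨M, hM, hΘM⟩ := hchain.directedOn.exists_mem_subset_of_finite_of_subset_sUnion hne hfin hΘ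
  exact hinc ((hc hM).2.anti (union_neg_image_mono hΘM))

/-- The right-hand side is stability in logical terms: what `S` omits is refuted as an assumption.
-/
theorem maximal_compatible_iff {S : Set F} : Maximal (Compatible L Ω Γ) S ↔
    Compatible L Ω Γ S ∧ ∀ B ∈ Ω, B ∉ S → L.entails (Γ ∪ neg '' S) B := by
  constructor
  · refine fun h => ⟨h.prop, fun B hB hBS => ?_⟩
    refine CoreLogic.entails_of_not_consistent_neg fun hc => hBS ?_
    refine h.le_of_ge (y := S ∪ {B}) ⟨Set.union_subset h.prop.1 (by simpa using hB), ?_⟩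
      Set.subset_union_left (Or.inr rfl)
    rwa [Set.image_union, Set.image_singleton, ← Set.union_assoc]
  · rintro ⟨hS, h⟩
    refine ⟨hS, fun S' hS' hle B hB => ?_⟩
    by_contra hBS
    refine CoreLogic.not_consistent_of_contradiction (B := B) ?_ ?_ hS'.2
    · exact L.monotonicity (union_neg_image_mono hle) (h B (hS'.1 hB) hBS)
    · exact L.reflexivity (Or.inr ⟨B, hB, rfl⟩)

theorem Compatible.mem_of_entails_neg {S : Set F} (h : Maximal (Compatible L Ω Γ) S) {B : F}
    (hB : B ∈ Ω) (hS : L.entails (Γ ∪ neg '' S) (neg B)) : B ∈ S := by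
  by_contra hBS
  exact CoreLogic.not_consistent_of_contradiction ((maximal_compatible_iff.1 h).2 B hB hBS) hS
    h.prop.2

/-- An abnormality outside a maximal set completes a finite set of abnormalities inside it to one
whose disjunction follows. -/
theorem exists_dab_of_not_mem {S : Set F} (h : Maximal (Compatible L Ω Γ) S) {B : F} (hB : B ∈ Ω)
    (hBS : B ∉ S) : ∃ Δ ∈ dabs L Ω Γ, Δ ⊆ insert B S := by
  have hinc : ¬ L.Consistent (Γ ∪ neg '' insert B S) := fun hc =>
    hBS (h.le_of_ge (y := insert B S) ⟨Set.insert_subset hB h.prop.1, hc⟩ (Set.subset_insert B S)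
      (Set.mem_insert B S))
  obtain ⟨Θ, hΘ, hfin, hΘinc⟩ := CoreLogic.exists_finite_of_not_consistent hinc
  -- Inserting `B` secures non-emptiness, as `Θ` may be empty.
  refine ⟨insert B Θ, ⟨Set.insert_subset hB (hΘ.trans (Set.insert_subset hB h.prop.1)),
    hfin.insert B, Set.insert_nonempty B Θ, fun hc => hΘinc ?_⟩,
    Set.insert_subset (Set.mem_insert B S) hΘ⟩
  exact hc.anti (union_neg_image_mono (Set.subset_insert B Θ))

theorem Compatible.not_dab_subset {S Δ : Set F} (hS : Compatible L Ω Γ S) (hΔ : Δ ∈ dabs L Ω Γ) :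
    ¬ Δ ⊆ S := fun h => hΔ.2.2.2 (hS.anti h).2

/-- The complements of the maximal sets are minimal choice sets. -/
theorem diff_mem_minimalChoiceSets {S : Set F} (h : Maximal (Compatible L Ω Γ) S) :
    Ω \ S ∈ minimalChoiceSets (dabs L Ω Γ) := by
  refine ⟨fun Δ hΔ => ?_, fun φ hφ hle B hB => ?_⟩
  · obtain ⟨B, hB, hBS⟩ := Set.not_subset.1 (h.prop.not_dab_subset hΔ)
    exact ⟨B, hB, hΔ.1 hB, hBS⟩
  · obtain ⟨Δ, hΔ, hsub⟩ := exists_dab_of_not_mem h hB.1 hB.2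
    obtain ⟨C, hC, hCφ⟩ := hφ Δ hΔ
    rcases hsub hC with rfl | hCS
    · exact hCφ
    · exact absurd hCS (hle hCφ).2

/-- The complements of the minimal choice sets are maximal sets. -/
theorem maximal_diff_of_mem_minimalChoiceSets (hΓ : L.Consistent Γ) {φ : Set F}
    (hφ : φ ∈ minimalChoiceSets (dabs L Ω Γ)) : Maximal (Compatible L Ω Γ) (Ω \ φ) := by
  replace hφ : Minimal (fun Θ : Set F => ∀ Δ ∈ dabs L Ω Γ, (Δ ∩ Θ).Nonempty) φ := hφ
  have hcompat : Compatible L Ω Γ (Ω \ φ) := by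
    refine ⟨Set.sdiff_subset, ?_⟩
    by_contra hinc
    obtain ⟨Θ, hΘ, hfin, hΘinc⟩ := CoreLogic.exists_finite_of_not_consistent hinc
    have hne : Θ.Nonempty := by
      rw [Set.nonempty_iff_ne_empty]
      rintro rfl
      rw [Set.image_empty, Set.union_empty] at hΘinc
      exact hΘinc hΓ
    obtain ⟨B, hB, hBφ⟩ := hφ.prop Θ ⟨hΘ.trans Set.sdiff_subset, hfin, hne, hΘinc⟩
    exact (hΘ hB).2 hBφ
  refine ⟨hcompat, fun S hS hle B hB => ⟨hS.1 hB, fun hBφ => ?_⟩⟩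
  -- No derivable disjunction has all its disjuncts in `S`, so `φ \ S` still meets each of them;
  -- minimality of `φ` then keeps `S` disjoint from `φ`.
  refine (hφ.le_of_le (y := φ \ S) (fun Δ hΔ => ?_) Set.sdiff_subset hBφ).2 hB
  obtain ⟨C, hC, hCS⟩ := Set.not_subset.1 (hS.not_dab_subset hΔ)
  refine ⟨C, hC, ?_, hCS⟩
  by_contra hCφ
  exact hCS (hle ⟨hΔ.1 hC, hCφ⟩)

theorem Compatible.empty (hΓ : L.Consistent Γ) : Compatible L Ω Γ ∅ :=
  ⟨Set.empty_subset _, by rwa [Set.image_empty, Set.union_empty]⟩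

/-- Needed for the first marking clause of minimal abnormality. If `Γ` is inconsistent, every
singleton from `Ω` is a derivable disjunction, which makes `Ω` itself a minimal choice set. -/
theorem minimalChoiceSets_dabs_nonempty (L : CoreLogic F) (Ω Γ : Set F) :
    (minimalChoiceSets (dabs L Ω Γ)).Nonempty := by
  by_cases hΓ : L.Consistent Γ
  · obtain ⟨M, -, hM⟩ := (Compatible.empty (Ω := Ω) hΓ).exists_maximal
    exact ⟨_, diff_mem_minimalChoiceSets hM⟩
  · refine ⟨Ω, fun Δ hΔ => ?_, fun φ hφ _ B hB => ?_⟩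
    · obtain ⟨B, hB⟩ := hΔ.2.2.1
      exact ⟨B, hB, hΔ.1 hB⟩
    · obtain ⟨C, rfl, hC⟩ := hφ {B} ⟨Set.singleton_subset_iff.2 hB, Set.finite_singleton B,
        Set.singleton_nonempty B, fun hc => hΓ (hc.anti Set.subset_union_left)⟩
      exact hC

/-- The abnormalities that are false in all maximal sets are those that do not occur in a minimal
disjunction of abnormalities. -/
theorem forall_maximal_mem_iff (hΓ : L.Consistent Γ) {B : F} (hB : B ∈ Ω) :
    (∀ M, Maximal (Compatible L Ω Γ) M → B ∈ M) ↔
      ∀ Δ, Minimal (· ∈ dabs L Ω Γ) Δ → B ∉ Δ := by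
  constructor
  · intro h Δ hΔ hBΔ
    -- Minimality of `Δ` makes the remaining disjuncts compatible; a maximal set containing them
    -- would contain all of `Δ` if it also contained `B`.
    have hcompat : Compatible L Ω Γ (Δ \ {B}) := by
      rcases (Δ \ {B}).eq_empty_or_nonempty with he | hne
      · rw [he]
        exact .empty hΓ
      · refine ⟨Set.sdiff_subset.trans hΔ.prop.1, ?_⟩
        by_contra hinc
        exact (hΔ.le_of_le (y := Δ \ {B}) ⟨Set.sdiff_subset.trans hΔ.prop.1,
          hΔ.prop.2.1.subset Set.sdiff_subset, hne, hinc⟩ Set.sdiff_subset hBΔ).2 rfl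
    obtain ⟨M, hsub, hM⟩ := hcompat.exists_maximal
    refine hM.prop.not_dab_subset hΔ.prop fun C hC => ?_
    by_cases hCB : C = B
    · exact hCB ▸ h M hM
    · exact hsub ⟨hC, hCB⟩
  · intro h M hM
    by_contra hBM
    obtain ⟨Δ, hΔ, hsub⟩ := exists_dab_of_not_mem hM hB hBM
    obtain ⟨Δ', hle, hmin⟩ := exists_minimal_subset hΔ.2.1 hΔ
    refine hM.prop.not_dab_subset hmin.prop fun C hC => ?_
    rcases hsub (hle hC) with rfl | hCM
    · exact absurd hC (h Δ' hmin)
    · exact hCM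

/-! ### The three consequence relations in terms of maximal sets -/

theorem sound_empty_iff {A : F} : Sound L Ω Γ ⟨A, ∅⟩ ↔ L.entails Γ A := by
  simp [Sound]

theorem adaptiveConsequence_normalSelections_iff (hΓ : L.Consistent Γ) {A : F} :
    AdaptiveConsequence L Ω .normalSelections Γ A ↔
      ∃ M, Maximal (Compatible L Ω Γ) M ∧ L.entails (Γ ∪ neg '' M) A := by
  rw [adaptiveConsequence_iff]
  constructor
  · rintro ⟨Θ, ⟨hΘ, hfin, hA⟩, hm⟩
    have hcompat : Compatible L Ω Γ Θ := by
      rcases Θ.eq_empty_or_nonempty with rfl | hne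
      · exact .empty hΓ
      · exact ⟨hΘ, by_contra fun hinc => hm ⟨hΘ, hfin, hne, hinc⟩⟩
    obtain ⟨M, hsub, hM⟩ := hcompat.exists_maximal
    exact ⟨M, hM, L.monotonicity (union_neg_image_mono hsub) hA⟩
  · rintro ⟨M, hM, hA⟩
    obtain ⟨Θ, hΘ, hfin, hA⟩ := CoreLogic.exists_finite_of_entails hA
    exact ⟨Θ, ⟨hΘ.trans hM.prop.1, hfin, hA⟩, fun hm => hM.prop.not_dab_subset hm hΘ⟩

theorem adaptiveConsequence_minimalAbnormality_iff {A : F} :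
    AdaptiveConsequence L Ω .minimalAbnormality Γ A ↔
      ∀ M, Maximal (Compatible L Ω Γ) M → L.entails (Γ ∪ neg '' M) A := by
  have hiff : AdaptiveConsequence L Ω .minimalAbnormality Γ A ↔
      ∀ φ ∈ minimalChoiceSets (dabs L Ω Γ), ∃ Θ, Sound L Ω Γ ⟨A, Θ⟩ ∧ Disjoint Θ φ := by
    rw [adaptiveConsequence_iff]
    constructor
    · rintro ⟨Θ, -, hm⟩ φ hφ
      by_contra hno
      exact hm (Or.inr ⟨φ, hφ, hno⟩)
    · intro h
      obtain ⟨φ, hφ⟩ := minimalChoiceSets_dabs_nonempty L Ω Γ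
      obtain ⟨Θ, hs, hd⟩ := h φ hφ
      refine ⟨Θ, hs, ?_⟩
      rintro (hno | ⟨φ', hφ', hno⟩)
      · exact hno ⟨φ, hφ, hd⟩
      · exact hno (h φ' hφ')
  rw [hiff]
  constructor
  · intro h M hM
    obtain ⟨Θ, ⟨hΘ, -, hA⟩, hd⟩ := h _ (diff_mem_minimalChoiceSets hM)
    refine L.monotonicity (union_neg_image_mono fun B hB => ?_) hA
    by_contra hBM
    exact Set.disjoint_left.1 hd hB ⟨hΘ hB, hBM⟩
  · intro h φ hφ
    by_cases hΓ : L.Consistent Γ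
    · obtain ⟨Θ, hΘ, hfin, hA⟩ := CoreLogic.exists_finite_of_entails
        (h _ (maximal_diff_of_mem_minimalChoiceSets hΓ hφ))
      exact ⟨Θ, ⟨hΘ.trans Set.sdiff_subset, hfin, hA⟩,
        Set.disjoint_left.2 fun B hB => (hΘ hB).2⟩
    · exact ⟨∅, sound_empty_iff.2 (CoreLogic.not_consistent_iff.1 hΓ A), Set.empty_disjoint φ⟩

theorem adaptiveConsequence_reliability_iff {A : F} :
    AdaptiveConsequence L Ω .reliability Γ A ↔
      L.entails (Γ ∪ ⋂₀ ((neg '' ·) '' {M | Maximal (Compatible L Ω Γ) M})) A := by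
  rw [adaptiveConsequence_iff]
  by_cases hΓ : L.Consistent Γ
  · obtain ⟨M₀, -, hM₀⟩ := (Compatible.empty (Ω := Ω) hΓ).exists_maximal
    -- Injectivity of `neg` and the existence of some `M₀` let the intersection pass inside the
    -- image.
    have hinter : ⋂₀ ((neg '' ·) '' {M | Maximal (Compatible L Ω Γ) M}) =
        neg '' {B | B ∈ Ω ∧ ∀ M, Maximal (Compatible L Ω Γ) M → B ∈ M} := by
      ext C
      constructor
      · intro hC
        obtain ⟨B, hB, rfl⟩ := hC _ ⟨M₀, hM₀, rfl⟩
        refine ⟨B, ⟨hM₀.prop.1 hB, fun M hM => ?_⟩, rfl⟩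
        exact (FormalLanguage.neg_injective.mem_set_image).1 (hC _ ⟨M, hM, rfl⟩)
      · rintro ⟨B, ⟨-, hB⟩, rfl⟩ _ ⟨M, hM, rfl⟩
        exact ⟨B, hB M hM, rfl⟩
    rw [hinter]
    constructor
    · rintro ⟨Θ, ⟨hΘ, -, hA⟩, hm⟩
      refine L.monotonicity (union_neg_image_mono fun B hB => ⟨hΘ hB, ?_⟩) hA
      exact (forall_maximal_mem_iff hΓ (hΘ hB)).2 fun Δ hΔ hBΔ => hm ⟨Δ, hΔ, B, hB, hBΔ⟩
    · intro h
      obtain ⟨Θ, hΘ, hfin, hA⟩ := CoreLogic.exists_finite_of_entails h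
      refine ⟨Θ, ⟨fun B hB => (hΘ hB).1, hfin, hA⟩, ?_⟩
      rintro ⟨Δ, hΔ, B, hB, hBΔ⟩
      exact (forall_maximal_mem_iff hΓ (hΘ hB).1).1 (hΘ hB).2 Δ hΔ hBΔ
  -- For inconsistent `Γ` both sides hold: the empty condition is never marked under reliability.
  · have hA : L.entails Γ A := CoreLogic.not_consistent_iff.1 hΓ A
    refine iff_of_true ⟨∅, sound_empty_iff.2 hA, ?_⟩ (L.monotonicity Set.subset_union_left hA)
    rintro ⟨Δ, -, B, hB, -⟩
    exact hB

/-! ### Extensions of the translated framework -/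


variable {R : Set (InferenceRule F)} {hΩ : Ω.Nonempty}


theorem translation_assumptions :
    (translation R Ω hΩ Γ).assumptions = neg '' Ω := by
  ext B
  simp only [translation, Set.mem_ofPred_eq, Set.mem_image, eq_comm]

theorem translation_follows_iff (hR : L.CharacterisedBy R) {Δ : Set F} {A : F} :
    (translation R Ω hΩ Γ).Follows Δ A ↔ L.entails (Γ ∪ Δ) A :=
  hR.derives_iff

theorem translation_forall_assumption {p : (translation R Ω hΩ Γ).assumptions → Prop} :
    (∀ a, p a) ↔ ∀ B, ∀ hB : B ∈ Ω, p ⟨neg B, B, hB, rfl⟩ := by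
  constructor
  · exact fun h B hB => h _
  · rintro h ⟨_, B, hB, rfl⟩
    exact h B hB

/-- Non-emptiness of `Ω` matters: some assumption is needed for conflict-freeness to exhibit an
underivable sentence. -/
theorem translation_conflictFree_iff (hR : L.CharacterisedBy R) {Δ : Set F} :
    (translation R Ω hΩ Γ).ConflictFree Δ ↔ Δ ⊆ neg '' Ω ∧ L.Consistent (Γ ∪ Δ) := by
  refine and_congr (by rw [translation_assumptions]) ?_
  rw [translation_forall_assumption]
  constructor
  · intro h
    obtain ⟨B, hB⟩ := id hΩ
    rcases h B hB with h | h
    · exact ⟨_, mt (translation_follows_iff hR).2 h⟩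
    · exact ⟨_, mt (translation_follows_iff hR).2 h⟩
  · intro h B hB
    rw [translation_contrary R Ω hΩ Γ B hB, translation_follows_iff hR, translation_follows_iff hR]
    by_contra! hno
    exact CoreLogic.not_consistent_of_contradiction hno.2 hno.1 h

theorem translation_conflictFree_image_iff (hR : L.CharacterisedBy R) {S : Set F} :
    (translation R Ω hΩ Γ).ConflictFree (neg '' S) ↔ Compatible L Ω Γ S := by
  rw [translation_conflictFree_iff hR, Compatible, Set.image_subset_image_iff FormalLanguage.neg_injective]

theorem translation_exists_image_of_subset {Δ : Set F}
    (hΔ : Δ ⊆ (translation R Ω hΩ Γ).assumptions) : ∃ S ⊆ Ω, neg '' S = Δ := by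
  rw [translation_assumptions] at hΔ
  exact Set.subset_image_iff.1 hΔ

theorem translation_maximal_conflictFree_iff (hR : L.CharacterisedBy R) {S : Set F} :
    Maximal (translation R Ω hΩ Γ).ConflictFree (neg '' S) ↔ Maximal (Compatible L Ω Γ) S := by
  constructor
  · intro h
    refine ⟨(translation_conflictFree_image_iff hR).1 h.prop, fun S' hS' hle => ?_⟩
    exact (Set.image_subset_image_iff FormalLanguage.neg_injective).1 (h.le_of_ge
      ((translation_conflictFree_image_iff hR).2 hS') (Set.image_mono hle))
  · intro h
    refine ⟨(translation_conflictFree_image_iff hR).2 h.prop, fun Δ hΔ hle => ?_⟩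
    obtain ⟨S', -, rfl⟩ := translation_exists_image_of_subset hΔ.1
    exact Set.image_mono (h.le_of_ge ((translation_conflictFree_image_iff hR).1 hΔ)
      ((Set.image_subset_image_iff FormalLanguage.neg_injective).1 hle))

theorem translation_closed_of_maximal (hR : L.CharacterisedBy R) {S : Set F}
    (h : Maximal (Compatible L Ω Γ) S) : (translation R Ω hΩ Γ).Closed (neg '' S) := by
  refine Set.Subset.antisymm ?_ ?_
  · rintro _ ⟨B, hB, rfl⟩
    exact ⟨⟨B, h.prop.1 hB, rfl⟩,
      (translation_follows_iff hR).2 (L.reflexivity (Or.inr ⟨B, hB, rfl⟩))⟩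
  · rintro _ ⟨⟨B, hB, rfl⟩, hfol⟩
    exact ⟨B, Compatible.mem_of_entails_neg h hB ((translation_follows_iff hR).1 hfol), rfl⟩

theorem translation_attacks_iff (hR : L.CharacterisedBy R) {Δ : Set F} {B : F} (hB : B ∈ Ω) :
    (translation R Ω hΩ Γ).Attacks Δ ⟨neg B, B, hB, rfl⟩ ↔ L.entails (Γ ∪ Δ) B := by
  rw [ABFramework.Attacks, translation_contrary R Ω hΩ Γ B hB, translation_follows_iff hR]

theorem translation_naive_iff (hR : L.CharacterisedBy R) {S : Set F} :
    (translation R Ω hΩ Γ).Naive (neg '' S) ↔ Maximal (Compatible L Ω Γ) S :=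
  ⟨fun h => (translation_maximal_conflictFree_iff hR).1 h.2,
    fun h => ⟨translation_closed_of_maximal hR h, (translation_maximal_conflictFree_iff hR).2 h⟩⟩

theorem translation_stable_iff (hR : L.CharacterisedBy R) {S : Set F} :
    (translation R Ω hΩ Γ).Stable (neg '' S) ↔ Maximal (Compatible L Ω Γ) S := by
  have hatt : (∀ a : (translation R Ω hΩ Γ).assumptions, (a : F) ∉ neg '' S →
      (translation R Ω hΩ Γ).Attacks (neg '' S) a) ↔
      ∀ B ∈ Ω, B ∉ S → L.entails (Γ ∪ neg '' S) B := by
    rw [translation_forall_assumption]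
    refine forall₂_congr fun B hB => ?_
    rw [translation_attacks_iff hR hB, FormalLanguage.neg_injective.mem_set_image]
  rw [ABFramework.Stable, hatt, translation_conflictFree_image_iff hR, ← maximal_compatible_iff]
  exact ⟨fun h => h.2, fun h => ⟨translation_closed_of_maximal hR h, h⟩⟩

theorem translation_admissible_of_maximal (hR : L.CharacterisedBy R) {S : Set F}
    (h : Maximal (Compatible L Ω Γ) S) : (translation R Ω hΩ Γ).Admissible (neg '' S) := by
  refine ⟨translation_closed_of_maximal hR h, (translation_conflictFree_image_iff hR).2 h.prop, ?_⟩
  rintro Δ hΔ - ⟨⟨_, B, hB, rfl⟩, hmem, hatt⟩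
  obtain ⟨S', hS', rfl⟩ := translation_exists_image_of_subset hΔ
  -- An attacker cannot lie inside the consistent set it attacks, so it contains an assumption
  -- outside, which `neg '' S` attacks by maximality.
  have hns : ¬ S' ⊆ S := fun hle => CoreLogic.not_consistent_of_contradiction
    (L.monotonicity (union_neg_image_mono hle) ((translation_attacks_iff hR hB).1 hatt))
    (L.reflexivity (Or.inr hmem)) h.prop.2
  obtain ⟨C, hC, hCS⟩ := Set.not_subset.1 hns
  exact ⟨⟨neg C, C, hS' hC, rfl⟩, ⟨C, hC, rfl⟩, (translation_attacks_iff hR (hS' hC)).2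
    ((maximal_compatible_iff.1 h).2 C (hS' hC) hCS)⟩

/-- An admissible set is conflict-free, hence lies in some `neg '' M`, which is itself admissible.
Maximal admissible and maximal conflict-free sets therefore agree. -/
theorem translation_preferred_iff (hR : L.CharacterisedBy R) {S : Set F} :
    (translation R Ω hΩ Γ).Preferred (neg '' S) ↔ Maximal (Compatible L Ω Γ) S := by
  constructor
  · intro h
    obtain ⟨M, hsub, hM⟩ :=
      ((translation_conflictFree_image_iff hR).1 h.prop.2.1).exists_maximal
    have hle := (Set.image_subset_image_iff FormalLanguage.neg_injective).1 (h.le_of_ge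
      (translation_admissible_of_maximal hR hM) (Set.image_mono hsub))
    rwa [Set.Subset.antisymm hsub hle]
  · intro h
    exact ⟨translation_admissible_of_maximal hR h, fun Δ hΔ hle =>
      ((translation_maximal_conflictFree_iff hR).2 h).le_of_ge hΔ.2.1 hle⟩

/-- Naive, preferred and stable extensions coincide: they consist of the negations of the members
of the maximal sets of abnormalities that may consistently be assumed to be false. -/
theorem translation_extensions (hR : L.CharacterisedBy R) (sem : Semantics) :
    (translation R Ω hΩ Γ).extensions sem =
      (neg '' ·) '' {M | Maximal (Compatible L Ω Γ) M} := by
  have key : ∀ p : Set F → Prop, (∀ Δ, p Δ → Δ ⊆ (translation R Ω hΩ Γ).assumptions) →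
      (∀ S, p (neg '' S) ↔ Maximal (Compatible L Ω Γ) S) →
      {Δ | p Δ} = (neg '' ·) '' {M | Maximal (Compatible L Ω Γ) M} := by
    intro p hsub hp
    apply Set.Subset.antisymm
    · intro Δ hΔ
      obtain ⟨S, -, rfl⟩ := translation_exists_image_of_subset (hsub Δ hΔ)
      exact ⟨S, (hp S).1 hΔ, rfl⟩
    · rintro _ ⟨M, hM, rfl⟩
      exact (hp M).2 hM
  cases sem with
  | naive => exact key _ (fun _ h => h.2.prop.1) fun _ => translation_naive_iff hR
  | preferred => exact key _ (fun _ h => h.prop.2.1.1) fun _ => translation_preferred_iff hR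
  | stable => exact key _ (fun _ h => h.2.1.1) fun _ => translation_stable_iff hR

end AdaptiveABA

/-! ### The correspondence of strategies and argumentative consequence -/

theorem theorem4 {F : Type u} [AdaptiveABA.FormalLanguage F] (L : AdaptiveABA.CoreLogic F)
    (R : Set (AdaptiveABA.InferenceRule F)) (hR : L.CharacterisedBy R)
    (Ω : Set F) (hΩ : Ω.Nonempty) (Γ : Set F) (A : F) (sem : AdaptiveABA.Semantics) :
    (L.Consistent Γ →
      ((AdaptiveABA.translation R Ω hΩ Γ).Credulous sem A ↔
        AdaptiveABA.AdaptiveConsequence L Ω .normalSelections Γ A)) ∧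
    ((AdaptiveABA.translation R Ω hΩ Γ).Skeptical sem A ↔
      AdaptiveABA.AdaptiveConsequence L Ω .minimalAbnormality Γ A) ∧
    ((AdaptiveABA.translation R Ω hΩ Γ).FromIntersection sem A ↔
      AdaptiveABA.AdaptiveConsequence L Ω .reliability Γ A) := by
  simp only [AdaptiveABA.ABFramework.Credulous, AdaptiveABA.ABFramework.Skeptical,
    AdaptiveABA.ABFramework.FromIntersection, AdaptiveABA.translation_extensions hR,
    AdaptiveABA.translation_follows_iff hR, Set.exists_mem_image, Set.forall_mem_image,
    Set.mem_ofPred_eq]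
  exact ⟨fun hΓ => (AdaptiveABA.adaptiveConsequence_normalSelections_iff hΓ).symm,
    AdaptiveABA.adaptiveConsequence_minimalAbnormality_iff.symm,
    AdaptiveABA.adaptiveConsequence_reliability_iff.symm⟩
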